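/- Let $G\rightrightarrows P$ be a Lie groupoid: $G$ and $P$ are smooth, finite-dimensional Hausdorff manifolds, the source and target maps $\mathsf s,\mathsf t:G\to P$ are surjective submersions, and the object inclusion $P\hookrightarrow G$, $p\mapsto 1_p$, and the partial multiplication $\mathsf m$, defined on $\{(g,h)\mid \mathsf s(g)=\mathsf t(h)\}$, are smooth. Consider $P$ as a subset of $G$. Write $T^{\mathsf s}G=\ker T\mathsf s$, $T^{\mathsf t}G=\ker T\mathsf t$, and $W^\circ$ for the annihilator of $W$; let $AG=T^{\mathsf t}_PG$ and identify its dual $A^*G$ with $(TP)^\circ\subseteq T^*_PG$ by means of $T_PG=TP\oplus AG$. The Pontryagin groupoid $TG\oplus T^*G\rightrightarrows TP\oplus A^*G$ is the direct sum of the tangent groupoid $TG\rightrightarrows TP$ (all structure maps are the tangent maps) and the cotangent groupoid $T^*G\rightrightarrows A^*G$, in which, for $\alpha\in T_g^*G$, $\hat{\mathsf s}(\alpha)(u)=\alpha(TL_g u)$ for $u\in A_{\mathsf s(g)}G$, $\hat{\mathsf t}(\alpha)(u)=\alpha(TR_g(u-T\mathsf s\,u))$ for $u\in A_{\mathsf t(g)}G$,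 and $(\alpha\star\beta)(T\mathsf m(v,w))=\alpha(v)+\beta(w)$ for all composable $v,w$. Let $\mathsf D_G\subseteq TG\oplus T^*G$ be a multiplicative (almost) Dirac structure, i.e. a smooth vector subbundle that equals its orthogonal for the pairing $\langle(v,\alpha),(w,\beta)\rangle=\alpha(w)+\beta(v)$ and that is a subgroupoid of the Pontryagin groupoid. No integrability of $\mathsf D_G$ is assumed. Over $P$ put $$\mathfrak A(\mathsf D_G)=\mathsf D_G\cap(TP\oplus A^*G),\quad I^{\mathsf t}(\mathsf D_G)=\mathsf D_G\cap\bigl(T^{\mathsf t}_PG\oplus(T^{\mathsf s}_PG)^\circ\bigr),\quad I^{\mathsf s}(\mathsf D_G)=\mathsf D_G\cap\bigl(T^{\mathsf s}_PG\oplus(T^{\mathsf t}_PG)^\circ\bigr).$$ Then the restriction of $\mathsf D_G$ to the units splits as a direct sum in two ways, $$\mathsf D_G|_P=\mathfrak A(\mathsf D_G)\oplus I^{\mathsf t}(\mathsf D_G)\qquad\text{and}\qquad \mathsf D_G|_P=\mathfrak A(\mathsf D_G)\oplus I^{\mathsf s}(\mathsf D_G).$$ Moreover, each of the three intersections $\mathfrak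 A(\mathsf D_G)$, $I^{\mathsf t}(\mathsf D_G)$ and $I^{\mathsf s}(\mathsf D_G)$ is a smooth vector subbundle of $(TG\oplus T^*G)|_P$; its rank is locally constant on $P$, hence constant on every connected component of $P$ (and on $P$, if $P$ is connected). -/

import Mathlib

open scoped Manifold ContDiff Bundle

noncomputable section

/-- A Lie groupoid `G ⇉ P`; `G` and `P` are smooth manifolds modelled on `E` and `F`.

The partial multiplication is a function `mul : G → G → G` of which only the values at
composable pairs `(g, h)`, i.e. those with `src g = tgt h`, carry any meaning: every axiom,
and every later definition, only looks at composable pairs. -/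
structure LieGroupoid (E F : Type*) [NormedAddCommGroup E] [NormedSpace ℝ E]
    [NormedAddCommGroup F] [NormedSpace ℝ F]
    (G P : Type*) [TopologicalSpace G] [ChartedSpace E G]
    [TopologicalSpace P] [ChartedSpace F P] where
  /-- source map -/
  src : G → P
  /-- target map -/
  tgt : G → P
  /-- object inclusion `p ↦ 1_p` -/
  unit : P → G
  /-- partial multiplication -/
  mul : G → G → G
  /-- inversion -/
  inv : G → G
  src_unit : ∀ p, src (unit p) = p
  tgt_unit : ∀ p, tgt (unit p) = p
  src_mul : ∀ g h, src g = tgt h → src (mul g h) = src h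
  tgt_mul : ∀ g h, src g = tgt h → tgt (mul g h) = tgt g
  mul_assoc : ∀ g h k, src g = tgt h → src h = tgt k → mul (mul g h) k = mul g (mul h k)
  unit_mul : ∀ g, mul (unit (tgt g)) g = g
  mul_unit : ∀ g, mul g (unit (src g)) = g
  src_inv : ∀ g, src (inv g) = tgt g
  tgt_inv : ∀ g, tgt (inv g) = src g
  mul_inv : ∀ g, mul g (inv g) = unit (tgt g)
  inv_mul : ∀ g, mul (inv g) g = unit (src g)
  src_surjective : Function.Surjective src
  tgt_surjective : Function.Surjective tgt
  src_submersion : Manifold.IsSubmersion 𝓘(ℝ, E) 𝓘(ℝ, F) ∞ src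
  tgt_submersion : Manifold.IsSubmersion 𝓘(ℝ, E) 𝓘(ℝ, F) ∞ tgt
  unit_smooth : ContMDiff 𝓘(ℝ, F) 𝓘(ℝ, E) ∞ unit
  mul_smooth : ContMDiffOn (𝓘(ℝ, E).prod 𝓘(ℝ, E)) 𝓘(ℝ, E) ∞ (fun x : G × G => mul x.1 x.2)
    {x | src x.1 = tgt x.2}

section Pontryagin

variable (E : Type*) [NormedAddCommGroup E] [NormedSpace ℝ E]
  (G : Type*) [TopologicalSpace G] [ChartedSpace E G]

/-- The fibre `T_g G × T_g^* G` of the Pontryagin bundle `TG ⊕ T^*G`. -/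
abbrev PontryaginFiber : G → Type _ :=
  (TangentSpace 𝓘(ℝ, E) : G → Type _) ×ᵇ
    (fun g : G => TangentSpace 𝓘(ℝ, E) g →L[ℝ] Bundle.Trivial G ℝ g)

/-- The total space of the Pontryagin bundle `TG ⊕ T^*G`. -/
abbrev Pontryagin : Type _ := Bundle.TotalSpace (E × (E →L[ℝ] ℝ)) (PontryaginFiber E G)

variable {E G}

/-- The annihilator `W° ⊆ T_g^*G` of a linear subspace `W ⊆ T_g G`. -/
def cotangentAnnihilator {g : G} (W : Submodule ℝ (TangentSpace 𝓘(ℝ, E) g)) :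
    Submodule ℝ (TangentSpace 𝓘(ℝ, E) g →L[ℝ] ℝ) where
  carrier := {α | ∀ v ∈ W, α v = 0}
  add_mem' := fun {α β} hα hβ v hv => by
    rw [add_apply, hα v hv, hβ v hv, add_zero]
  zero_mem' := fun _ _ => rfl
  smul_mem' := fun c α hα v hv => by
    rw [smul_apply, hα v hv, smul_zero]

/-- The symmetric pairing `⟨(v, α), (w, β)⟩ = α(w) + β(v)`. -/
def pontryaginPairing {g : G} (ξ η : PontryaginFiber E G g) : ℝ := ξ.2 η.1 + η.2 ξ.1

/-- A family `W b ⊆ (TG ⊕ T^*G)_{f b}`, `b ∈ B`, of linear subspaces of the Pontryagin bundle along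
a map `f : B → G` is a smooth vector subbundle (of the pulled back bundle `f^*(TG ⊕ T^*G)`, so of
`TG ⊕ T^*G` for `f = id`, and of the restriction to `B` if `f` is an embedding): locally on `B` it
has a frame that consists of smooth sections. -/
def IsSmoothSubbundleAlong [IsManifold 𝓘(ℝ, E) ∞ G]
    {F : Type*} [NormedAddCommGroup F] [NormedSpace ℝ F]
    {B : Type*} [TopologicalSpace B] [ChartedSpace F B] (f : B → G)
    (W : ∀ b : B, Submodule ℝ (PontryaginFiber E G (f b))) : Prop :=
  ∀ b₀ : B, ∃ U : Set B, IsOpen U ∧ b₀ ∈ U ∧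
    ∃ (r : ℕ) (σ : Fin r → ∀ b : B, PontryaginFiber E G (f b)),
      (∀ i, ContMDiffOn 𝓘(ℝ, F) (𝓘(ℝ, E).prod 𝓘(ℝ, E × (E →L[ℝ] ℝ))) ∞
        (fun b => (⟨f b, σ i b⟩ : Pontryagin E G)) U) ∧
      ∀ b ∈ U, LinearIndependent ℝ (fun i => σ i b) ∧
        Submodule.span ℝ (Set.range fun i => σ i b) = W b

/-- An almost Dirac structure on `G`: a smooth vector subbundle `D` of `TG ⊕ T^*G` with
`D = D^⊥` for the pairing `pontryaginPairing`. -/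
structure IsAlmostDirac [IsManifold 𝓘(ℝ, E) ∞ G]
    (D : ∀ g : G, Submodule ℝ (PontryaginFiber E G g)) : Prop where
  smooth : IsSmoothSubbundleAlong (F := E) (fun g : G => g) D
  lagrangian : ∀ (g : G) (ξ : PontryaginFiber E G g),
    ξ ∈ D g ↔ ∀ η ∈ D g, pontryaginPairing ξ η = 0

end Pontryagin

namespace LieGroupoid

variable {E F : Type*} [NormedAddCommGroup E] [NormedSpace ℝ E]
  [NormedAddCommGroup F] [NormedSpace ℝ F]
  {G P : Type*} [TopologicalSpace G] [ChartedSpace E G]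
  [TopologicalSpace P] [ChartedSpace F P]
  (𝒢 : LieGroupoid E F G P)

/-- `T_g s : T_g G → T_{s(g)} P` -/
def dsrc (g : G) : TangentSpace 𝓘(ℝ, E) g →L[ℝ] TangentSpace 𝓘(ℝ, F) (𝒢.src g) :=
  mfderiv 𝓘(ℝ, E) 𝓘(ℝ, F) 𝒢.src g

/-- `T_g t : T_g G → T_{t(g)} P` -/
def dtgt (g : G) : TangentSpace 𝓘(ℝ, E) g →L[ℝ] TangentSpace 𝓘(ℝ, F) (𝒢.tgt g) :=
  mfderiv 𝓘(ℝ, E) 𝓘(ℝ, F) 𝒢.tgt g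

/-- `T_p ε : T_p P → T_{1_p} G` -/
def dunit (p : P) : TangentSpace 𝓘(ℝ, F) p →L[ℝ] TangentSpace 𝓘(ℝ, E) (𝒢.unit p) :=
  mfderiv 𝓘(ℝ, F) 𝓘(ℝ, E) 𝒢.unit p

/-- `T_g ι : T_g G → T_{g⁻¹} G`, with `ι` the inversion -/
def dinv (g : G) : TangentSpace 𝓘(ℝ, E) g →L[ℝ] TangentSpace 𝓘(ℝ, E) (𝒢.inv g) :=
  mfderiv 𝓘(ℝ, E) 𝓘(ℝ, E) 𝒢.inv g

/-- The derivative at `(g, h)` of the partial multiplication `m : G ×_P G → G`. It is meaningful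
if `src g = tgt h`, on the pairs `(v, w)` which are tangent to the submanifold `G ×_P G ⊆ G × G`,
i.e. such that `T s v = T t w`; on those the value of a derivative within `G ×_P G` is
unambiguous. -/
def dmul (g h : G) : TangentSpace 𝓘(ℝ, E) g × TangentSpace 𝓘(ℝ, E) h →L[ℝ]
    TangentSpace 𝓘(ℝ, E) (𝒢.mul g h) :=
  mfderivWithin (𝓘(ℝ, E).prod 𝓘(ℝ, E)) 𝓘(ℝ, E) (fun x : G × G => 𝒢.mul x.1 x.2)
    {x | 𝒢.src x.1 = 𝒢.tgt x.2} (g, h)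

/-- Composability `T s v = T t w` in the tangent groupoid `TG ⇉ TP`. -/
def TangentComposable {g h : G} (v : TangentSpace 𝓘(ℝ, E) g) (w : TangentSpace 𝓘(ℝ, E) h) : Prop :=
  (⟨𝒢.src g, 𝒢.dsrc g v⟩ : TangentBundle 𝓘(ℝ, F) P) = ⟨𝒢.tgt h, 𝒢.dtgt h w⟩

/-- The derivative at `1_{s(g)}` of the left translation `L_g : t⁻¹(s(g)) → t⁻¹(t(g))`, namely
`u ↦ T m (0_g, u)`; meaningful for `u ∈ ker T t`. The codomain uses `g ⋆ 1_{s(g)} = g`. -/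
def dleft (g : G) : TangentSpace 𝓘(ℝ, E) (𝒢.unit (𝒢.src g)) →L[ℝ] TangentSpace 𝓘(ℝ, E) g :=
  (𝒢.dmul g (𝒢.unit (𝒢.src g))).comp (ContinuousLinearMap.inr ℝ _ _)

/-- The derivative at `1_{t(g)}` of the right translation `R_g : s⁻¹(t(g)) → s⁻¹(s(g))`, namely
`u ↦ T m (u, 0_g)`; meaningful for `u ∈ ker T s`. The codomain uses `1_{t(g)} ⋆ g = g`. -/
def dright (g : G) : TangentSpace 𝓘(ℝ, E) (𝒢.unit (𝒢.tgt g)) →L[ℝ] TangentSpace 𝓘(ℝ, E) g :=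
  (𝒢.dmul (𝒢.unit (𝒢.tgt g)) g).comp (ContinuousLinearMap.inl ℝ _ _)

/-- The linear map `T ε ∘ T s` of `T_{1_p} G` to itself (as `s(1_p) = p`). -/
def dunitSrc (p : P) : TangentSpace 𝓘(ℝ, E) (𝒢.unit p) →L[ℝ] TangentSpace 𝓘(ℝ, E) (𝒢.unit p) :=
  (𝒢.dunit p).comp (𝒢.dsrc (𝒢.unit p))

/-- The linear map `T ε ∘ T t` of `T_{1_p} G` to itself (as `t(1_p) = p`). -/
def dunitTgt (p : P) : TangentSpace 𝓘(ℝ, E) (𝒢.unit p) →L[ℝ] TangentSpace 𝓘(ℝ, E) (𝒢.unit p) :=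
  (𝒢.dunit p).comp (𝒢.dtgt (𝒢.unit p))

/-- The source of `α ∈ T_g^*G` in the cotangent groupoid `T^*G ⇉ A^*G`. Here `A_p G = ker T_{1_p} t`
and `A_p^*G` is identified with the annihilator of `T_p P` in `T_{1_p}^*G` by means of
`T_{1_p} G = T_p P ⊕ A_p G`. So the formula `ŝ(α)(u) = α(T L_g u)`, `u ∈ A_{s(g)} G`, is applied to
the component `u = w - T ε (T t w)` of `w ∈ T_{1_{s(g)}} G`. -/
def cotangentSrc (g : G) (α : TangentSpace 𝓘(ℝ, E) g →L[ℝ] ℝ) :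
    TangentSpace 𝓘(ℝ, E) (𝒢.unit (𝒢.src g)) →L[ℝ] ℝ :=
  α.comp ((𝒢.dleft g).comp (ContinuousLinearMap.id ℝ _ - 𝒢.dunitTgt (𝒢.src g)))

/-- The target of `α ∈ T_g^*G` in the cotangent groupoid, with the same identification of `A^*G`.
The formula is `t̂(α)(u) = α(T R_g (u - T ε (T s u)))` for `u ∈ A_{t(g)} G`; for the component
`u = w - T ε (T t w)` of `w ∈ T_{1_{t(g)}} G` one has `u - T ε (T s u) = w - T ε (T s w)`. -/
def cotangentTgt (g : G) (α : TangentSpace 𝓘(ℝ, E) g →L[ℝ] ℝ) :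
    TangentSpace 𝓘(ℝ, E) (𝒢.unit (𝒢.tgt g)) →L[ℝ] ℝ :=
  α.comp ((𝒢.dright g).comp (ContinuousLinearMap.id ℝ _ - 𝒢.dunitSrc (𝒢.tgt g)))

/-- The unit over the source of an element `(v, α)` of the Pontryagin groupoid
`TG ⊕ T^*G ⇉ TP ⊕ A^*G`. The space of units `TP ⊕ A^*G` is regarded as a subset of `TG ⊕ T^*G`. -/
def pontryaginSrc (ξ : Pontryagin E G) : Pontryagin E G :=
  ⟨𝒢.unit (𝒢.src ξ.1),
    (𝒢.dunit (𝒢.src ξ.1) (𝒢.dsrc ξ.1 ξ.2.1), 𝒢.cotangentSrc ξ.1 ξ.2.2)⟩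

/-- The unit over the target of an element of the Pontryagin groupoid. -/
def pontryaginTgt (ξ : Pontryagin E G) : Pontryagin E G :=
  ⟨𝒢.unit (𝒢.tgt ξ.1),
    (𝒢.dunit (𝒢.tgt ξ.1) (𝒢.dtgt ξ.1 ξ.2.1), 𝒢.cotangentTgt ξ.1 ξ.2.2)⟩

/-- The inverse `(v, α)⁻¹ = (T ι v, -α ∘ T ι)` in the Pontryagin groupoid (as `(g⁻¹)⁻¹ = g`). -/
def pontryaginInv (ξ : Pontryagin E G) : Pontryagin E G :=
  ⟨𝒢.inv ξ.1, (𝒢.dinv ξ.1 ξ.2.1, -(ContinuousLinearMap.comp ξ.2.2 (𝒢.dinv (𝒢.inv ξ.1))))⟩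

/-- `ζ = ξ ⋆ η` in the Pontryagin groupoid: `ξ = (v, α)` and `η = (w, β)` are composable, the
tangent part of `ζ` is `T m (v, w)`, and its cotangent part `γ` is determined by
`γ(T m (v', w')) = α(v') + β(w')` for all composable `v'`, `w'`. -/
def IsPontryaginMul (ξ η ζ : Pontryagin E G) : Prop :=
  𝒢.pontryaginSrc ξ = 𝒢.pontryaginTgt η ∧
  ∃ γ : TangentSpace 𝓘(ℝ, E) (𝒢.mul ξ.1 η.1) →L[ℝ] ℝ,
    ζ = ⟨𝒢.mul ξ.1 η.1, (𝒢.dmul ξ.1 η.1 (ξ.2.1, η.2.1), γ)⟩ ∧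
    ∀ (v : TangentSpace 𝓘(ℝ, E) ξ.1) (w : TangentSpace 𝓘(ℝ, E) η.1), 𝒢.TangentComposable v w →
      γ (𝒢.dmul ξ.1 η.1 (v, w)) = ξ.2.2 v + η.2.2 w

/-- A subset of the Pontryagin groupoid is a subgroupoid (over the set of units it contains) if it
contains the units over the sources and targets of its elements and is closed under composition
and inversion. -/
structure IsPontryaginSubgroupoid (S : Set (Pontryagin E G)) : Prop where
  src_mem : ∀ ξ ∈ S, 𝒢.pontryaginSrc ξ ∈ S
  tgt_mem : ∀ ξ ∈ S, 𝒢.pontryaginTgt ξ ∈ S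
  mul_mem : ∀ ξ ∈ S, ∀ η ∈ S, ∀ ζ, 𝒢.IsPontryaginMul ξ η ζ → ζ ∈ S
  inv_mem : ∀ ξ ∈ S, 𝒢.pontryaginInv ξ ∈ S

/-- `(G ⇉ P, D)` is a Dirac groupoid: `D` is an almost Dirac structure on `G` (no integrability is
required) which is a subgroupoid of the Pontryagin groupoid `TG ⊕ T^*G ⇉ TP ⊕ A^*G`. -/
structure IsDiracGroupoid [IsManifold 𝓘(ℝ, E) ∞ G]
    (D : ∀ g : G, Submodule ℝ (PontryaginFiber E G g)) : Prop where
  almostDirac : IsAlmostDirac D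
  multiplicative : 𝒢.IsPontryaginSubgroupoid {ξ | ξ.2 ∈ D ξ.1}

/-- The fibre `T_p P ⊕ A_p^*G = T_p P ⊕ (T_p P)°` of the bundle of units, in `(TG ⊕ T^*G)_{1_p}`. -/
def unitBundle (p : P) : Submodule ℝ (PontryaginFiber E G (𝒢.unit p)) :=
  (𝒢.dunit p).range.prod (cotangentAnnihilator (𝒢.dunit p).range)

/-- The fibre of `ker 𝕋s = T^s G ⊕ (T^t G)°`, where `T^s G = ker T s` and `T^t G = ker T t`. -/
def kerSrc (g : G) : Submodule ℝ (PontryaginFiber E G g) :=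
  (𝒢.dsrc g).ker.prod (cotangentAnnihilator (𝒢.dtgt g).ker)

/-- The fibre of `ker 𝕋t = T^t G ⊕ (T^s G)°`. -/
def kerTgt (g : G) : Submodule ℝ (PontryaginFiber E G g) :=
  (𝒢.dtgt g).ker.prod (cotangentAnnihilator (𝒢.dsrc g).ker)

variable (D : ∀ g : G, Submodule ℝ (PontryaginFiber E G g))

/-- `𝔄(D) = D ∩ (TP ⊕ A^*G)` -/
def diracUnits (p : P) : Submodule ℝ (PontryaginFiber E G (𝒢.unit p)) :=
  D (𝒢.unit p) ⊓ 𝒢.unitBundle p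

/-- `I^s(D) = (D ∩ ker 𝕋s)|_P` -/
def diracCoreSrc (p : P) : Submodule ℝ (PontryaginFiber E G (𝒢.unit p)) :=
  D (𝒢.unit p) ⊓ 𝒢.kerSrc (𝒢.unit p)

/-- `I^t(D) = (D ∩ ker 𝕋t)|_P` -/
def diracCoreTgt (p : P) : Submodule ℝ (PontryaginFiber E G (𝒢.unit p)) :=
  D (𝒢.unit p) ⊓ 𝒢.kerTgt (𝒢.unit p)

/-- A family of linear subspaces of the restriction of `TG ⊕ T^*G` to the units is smooth and of
constant rank: it is a smooth vector subbundle, its rank is locally constant on `P`, and its rank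
is the same at any two points of a connected component of `P`. -/
structure IsSmoothOfConstantRank [IsManifold 𝓘(ℝ, E) ∞ G]
    (W : ∀ p : P, Submodule ℝ (PontryaginFiber E G (𝒢.unit p))) : Prop where
  smooth : IsSmoothSubbundleAlong (F := F) 𝒢.unit W
  rank_locally_constant : IsLocallyConstant fun p => Module.finrank ℝ (W p)
  rank_constant : ∀ p : P, ∀ q ∈ connectedComponent p,
    Module.finrank ℝ (W q) = Module.finrank ℝ (W p)

end LieGroupoid

end

/-!
Over a unit `1_p` the source map of the Pontryagin groupoid is the projection
`Q (v, α) = (T ε T s v, α ∘ (1 - T ε T t))`, and the target map is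
`Q' (v, α) = (T ε T t v, α ∘ (1 - T ε T s))`: differentiating `ε(t(g)) ⋆ g = g = g ⋆ ε(s(g))` shows
that the translations by units, which occur in the cotangent part, act trivially
(`pontryaginSrc_unit`, `pontryaginTgt_unit`). Since `D` is a subgroupoid, both projections preserve
`D` over `P`. As `T s T ε = 1 = T t T ε`, the image of `Q` lies in `TP ⊕ A^*G` and the image of
`1 - Q` in `T^s G ⊕ (T^t G)°`, and these two spaces are independent. So `ξ = Q ξ + (1 - Q) ξ` is
the splitting `D|_P = 𝔄(D) ⊕ I^s(D)`, and `Q'` gives the other splitting in the same way.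

The projections `Q`, `1 - Q`, `Q'` and `1 - Q'` all have the form `(v, α) ↦ (a v, α ∘ c)` with
smooth families `a`, `c` of endomorphisms of `T G` along `P`, and therefore preserve smoothness of sections
(`contMDiffOn_pontryaginFiberMap`). The image of a smooth subbundle under a smooth projection that
preserves it is a smooth subbundle, because the ranks of image and kernel are lower semicontinuous
with locally constant sum (`IsSmoothSubbundleAlong.of_add_eq_id`).
-/

noncomputable section

/-! ### Endomorphisms of the fibres of the Pontryagin bundle -/

section

variable {E : Type*} [NormedAddCommGroup E] [NormedSpace ℝ E]
  {G : Type*} [TopologicalSpace G] [ChartedSpace E G]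

/-- The endomorphism `(v, α) ↦ (a v, α ∘ b)` of a fibre of the Pontryagin bundle. -/
def pontryaginFiberMap {g : G} (a b : TangentSpace 𝓘(ℝ, E) g →L[ℝ] TangentSpace 𝓘(ℝ, E) g) :
    PontryaginFiber E G g →ₗ[ℝ] PontryaginFiber E G g where
  toFun ξ := (a ξ.1, ContinuousLinearMap.comp ξ.2 b)
  map_add' _ _ := Prod.ext (map_add a _ _) (ContinuousLinearMap.add_comp _ _ _)
  map_smul' _ _ := Prod.ext (map_smul a _ _) (ContinuousLinearMap.smul_comp _ _ _)

theorem pontryaginFiberMap_add_id_sub {g : G}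
    (a b : TangentSpace 𝓘(ℝ, E) g →L[ℝ] TangentSpace 𝓘(ℝ, E) g) (ξ : PontryaginFiber E G g) :
    pontryaginFiberMap a (ContinuousLinearMap.id ℝ _ - b) ξ +
      pontryaginFiberMap (ContinuousLinearMap.id ℝ _ - a) b ξ = ξ := by
  refine Prod.ext (add_sub_cancel (a ξ.1) ξ.1) (ContinuousLinearMap.ext fun v => ?_)
  change ξ.2 (v - b v) + ξ.2 (b v) = ξ.2 v
  rw [map_sub, sub_add_cancel]

end

namespace LieGroupoid

variable {E F : Type*} [NormedAddCommGroup E] [NormedSpace ℝ E]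
  [NormedAddCommGroup F] [NormedSpace ℝ F]
  {G P : Type*} [TopologicalSpace G] [ChartedSpace E G]
  [TopologicalSpace P] [ChartedSpace F P]
  (𝒢 : LieGroupoid E F G P)

/-! ### Differentials of the structure maps at the units -/

theorem src_contMDiff : ContMDiff 𝓘(ℝ, E) 𝓘(ℝ, F) ∞ 𝒢.src := 𝒢.src_submersion.contMDiff

theorem tgt_contMDiff : ContMDiff 𝓘(ℝ, E) 𝓘(ℝ, F) ∞ 𝒢.tgt := 𝒢.tgt_submersion.contMDiff

theorem hasMFDerivAt_src (g : G) : HasMFDerivAt 𝓘(ℝ, E) 𝓘(ℝ, F) 𝒢.src g (𝒢.dsrc g) :=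
  ((𝒢.src_contMDiff.mdifferentiable (by simp)) g).hasMFDerivAt

theorem hasMFDerivAt_tgt (g : G) : HasMFDerivAt 𝓘(ℝ, E) 𝓘(ℝ, F) 𝒢.tgt g (𝒢.dtgt g) :=
  ((𝒢.tgt_contMDiff.mdifferentiable (by simp)) g).hasMFDerivAt

theorem hasMFDerivAt_unit (p : P) : HasMFDerivAt 𝓘(ℝ, F) 𝓘(ℝ, E) 𝒢.unit p (𝒢.dunit p) :=
  ((𝒢.unit_smooth.mdifferentiable (by simp)) p).hasMFDerivAt

theorem hasMFDerivWithinAt_mul {g h : G} (hgh : 𝒢.src g = 𝒢.tgt h) :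
    HasMFDerivWithinAt (𝓘(ℝ, E).prod 𝓘(ℝ, E)) 𝓘(ℝ, E) (fun x : G × G => 𝒢.mul x.1 x.2)
      {x | 𝒢.src x.1 = 𝒢.tgt x.2} (g, h) (𝒢.dmul g h) :=
  ((𝒢.mul_smooth.mdifferentiableOn (by simp)) (g, h) hgh).hasMFDerivWithinAt

/-- `T s ∘ T ε = id`, from `s ∘ ε = id`. -/
theorem dsrc_dunit (p : P) (x : F) : (𝒢.dsrc (𝒢.unit p) (𝒢.dunit p x) : F) = x := by
  have h := (𝒢.hasMFDerivAt_src (𝒢.unit p)).comp p (𝒢.hasMFDerivAt_unit p)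
  have h' : HasMFDerivAt 𝓘(ℝ, F) 𝓘(ℝ, F) (𝒢.src ∘ 𝒢.unit) p
      (ContinuousLinearMap.id ℝ (TangentSpace 𝓘(ℝ, F) p)) :=
    (hasMFDerivAt_id p).congr_of_eventuallyEq (.of_forall 𝒢.src_unit)
  exact DFunLike.congr_fun (hasMFDerivAt_unique h h') x

/-- `T t ∘ T ε = id`, from `t ∘ ε = id`. -/
theorem dtgt_dunit (p : P) (x : F) : (𝒢.dtgt (𝒢.unit p) (𝒢.dunit p x) : F) = x := by
  have h := (𝒢.hasMFDerivAt_tgt (𝒢.unit p)).comp p (𝒢.hasMFDerivAt_unit p)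
  have h' : HasMFDerivAt 𝓘(ℝ, F) 𝓘(ℝ, F) (𝒢.tgt ∘ 𝒢.unit) p
      (ContinuousLinearMap.id ℝ (TangentSpace 𝓘(ℝ, F) p)) :=
    (hasMFDerivAt_id p).congr_of_eventuallyEq (.of_forall 𝒢.tgt_unit)
  exact DFunLike.congr_fun (hasMFDerivAt_unique h h') x

/-- Chain rule for a factorization `x = a(x) ⋆ b(x)` of the identity of `G`. As `(a, b)`
takes its values in the fibre product, no tangent vector has to be integrated to a curve in it. -/
theorem dmul_of_mul_eq_self {a b : G → G} (hab : ∀ x, 𝒢.src (a x) = 𝒢.tgt (b x))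
    (hmul : ∀ x, 𝒢.mul (a x) (b x) = x) (g : G)
    {a' : TangentSpace 𝓘(ℝ, E) g →L[ℝ] TangentSpace 𝓘(ℝ, E) (a g)}
    {b' : TangentSpace 𝓘(ℝ, E) g →L[ℝ] TangentSpace 𝓘(ℝ, E) (b g)}
    (ha : HasMFDerivAt 𝓘(ℝ, E) 𝓘(ℝ, E) a g a') (hb : HasMFDerivAt 𝓘(ℝ, E) 𝓘(ℝ, E) b g b')
    (v : E) : (𝒢.dmul (a g) (b g) (a' v, b' v) : E) = v := by
  have hm := HasMFDerivWithinAt.comp (f := fun x => (a x, b x)) g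
    (𝒢.hasMFDerivWithinAt_mul (hab g))
    ((ha.prodMk hb).hasMFDerivWithinAt (s := Set.univ)) (fun x _ => hab x)
  have h' : HasMFDerivAt 𝓘(ℝ, E) 𝓘(ℝ, E) ((fun x : G × G => 𝒢.mul x.1 x.2) ∘
      fun x => (a x, b x)) g (ContinuousLinearMap.id ℝ (TangentSpace 𝓘(ℝ, E) g)) :=
    (hasMFDerivAt_id g).congr_of_eventuallyEq (.of_forall hmul)
  exact DFunLike.congr_fun (hasMFDerivAt_unique (hasMFDerivWithinAt_univ.1 hm) h') v

/-- `T m (T ε (T t v), v) = v` at a unit, from `ε(t(g)) ⋆ g = g`. -/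
theorem dmul_unit_unit_tgt (p : P) (v : E) :
    (𝒢.dmul (𝒢.unit p) (𝒢.unit p) (𝒢.dunitTgt p v, v) : E) = v := by
  -- The base points `t(1_p)` and `p` are equal, but not by definition.
  have h : ∀ q, q = p → (𝒢.dmul (𝒢.unit q) (𝒢.unit p) (𝒢.dunit q (𝒢.dtgt (𝒢.unit p) v), v) : E) =
      𝒢.dmul (𝒢.unit p) (𝒢.unit p) (𝒢.dunitTgt p v, v) := by
    rintro _ rfl; rfl
  exact (h _ (𝒢.tgt_unit p)).symm.trans (𝒢.dmul_of_mul_eq_self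
    (fun x => 𝒢.src_unit (𝒢.tgt x)) 𝒢.unit_mul _
    ((𝒢.hasMFDerivAt_unit _).comp _ (𝒢.hasMFDerivAt_tgt _)) (hasMFDerivAt_id _) v)

/-- `T m (v, T ε (T s v)) = v` at a unit, from `g ⋆ ε(s(g)) = g`. -/
theorem dmul_unit_unit_src (p : P) (v : E) :
    (𝒢.dmul (𝒢.unit p) (𝒢.unit p) (v, 𝒢.dunitSrc p v) : E) = v := by
  have h : ∀ q, q = p → (𝒢.dmul (𝒢.unit p) (𝒢.unit q) (v, 𝒢.dunit q (𝒢.dsrc (𝒢.unit p) v)) : E) =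
      𝒢.dmul (𝒢.unit p) (𝒢.unit p) (v, 𝒢.dunitSrc p v) := by
    rintro _ rfl; rfl
  exact (h _ (𝒢.src_unit p)).symm.trans (𝒢.dmul_of_mul_eq_self
    (fun x => (𝒢.tgt_unit (𝒢.src x)).symm) 𝒢.mul_unit _
    (hasMFDerivAt_id _) ((𝒢.hasMFDerivAt_unit _).comp _ (𝒢.hasMFDerivAt_src _)) v)

theorem dunitTgt_idem (p : P) (v : TangentSpace 𝓘(ℝ, E) (𝒢.unit p)) :
    𝒢.dunitTgt p (𝒢.dunitTgt p v) = 𝒢.dunitTgt p v :=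
  congrArg (𝒢.dunit p) (𝒢.dtgt_dunit p _)

theorem dunitSrc_idem (p : P) (v : TangentSpace 𝓘(ℝ, E) (𝒢.unit p)) :
    𝒢.dunitSrc p (𝒢.dunitSrc p v) = 𝒢.dunitSrc p v :=
  congrArg (𝒢.dunit p) (𝒢.dsrc_dunit p _)

/-- Left translation by a unit is the identity of `ker T t`, onto which `1 - T ε ∘ T t`
projects. -/
theorem dmul_unit_unit_zero_left (p : P) (v : TangentSpace 𝓘(ℝ, E) (𝒢.unit p)) :
    (𝒢.dmul (𝒢.unit p) (𝒢.unit p) (0, v - 𝒢.dunitTgt p v) : E) = v - 𝒢.dunitTgt p v := by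
  have h := 𝒢.dmul_unit_unit_tgt p (v - 𝒢.dunitTgt p v)
  have h0 : 𝒢.dunitTgt p (v - 𝒢.dunitTgt p v) = 0 := by
    rw [map_sub, dunitTgt_idem, sub_self]
  rwa [h0] at h

/-- Right translation by a unit is the identity of `ker T s`, onto which `1 - T ε ∘ T s`
projects. -/
theorem dmul_unit_unit_zero_right (p : P) (v : TangentSpace 𝓘(ℝ, E) (𝒢.unit p)) :
    (𝒢.dmul (𝒢.unit p) (𝒢.unit p) (v - 𝒢.dunitSrc p v, 0) : E) = v - 𝒢.dunitSrc p v := by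
  have h := 𝒢.dmul_unit_unit_src p (v - 𝒢.dunitSrc p v)
  have h0 : 𝒢.dunitSrc p (v - 𝒢.dunitSrc p v) = 0 := by
    rw [map_sub, dunitSrc_idem, sub_self]
  rwa [h0] at h

/-- The source map of the Pontryagin groupoid over a unit. -/
theorem pontryaginSrc_unit (p : P) (ξ : PontryaginFiber E G (𝒢.unit p)) :
    𝒢.pontryaginSrc ⟨𝒢.unit p, ξ⟩ = ⟨𝒢.unit p,
      pontryaginFiberMap (𝒢.dunitSrc p) (ContinuousLinearMap.id ℝ _ - 𝒢.dunitTgt p) ξ⟩ := by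
  have key : ∀ q, q = p → (⟨𝒢.unit q, (𝒢.dunit q (𝒢.dsrc (𝒢.unit p) ξ.1),
      ContinuousLinearMap.comp (M₂ := E) ξ.2 (((𝒢.dmul (𝒢.unit p) (𝒢.unit q)).comp
        (ContinuousLinearMap.inr ℝ _ _)).comp
          (ContinuousLinearMap.id ℝ _ - 𝒢.dunitTgt q)))⟩ : Pontryagin E G) =
      ⟨𝒢.unit p,
        pontryaginFiberMap (𝒢.dunitSrc p) (ContinuousLinearMap.id ℝ _ - 𝒢.dunitTgt p) ξ⟩ := by
    rintro _ rfl
    congr 2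
    exact congrArg (ContinuousLinearMap.comp ξ.2)
      (ContinuousLinearMap.ext (𝒢.dmul_unit_unit_zero_left _))
  exact key _ (𝒢.src_unit p)

/-- The target map of the Pontryagin groupoid over a unit. -/
theorem pontryaginTgt_unit (p : P) (ξ : PontryaginFiber E G (𝒢.unit p)) :
    𝒢.pontryaginTgt ⟨𝒢.unit p, ξ⟩ = ⟨𝒢.unit p,
      pontryaginFiberMap (𝒢.dunitTgt p) (ContinuousLinearMap.id ℝ _ - 𝒢.dunitSrc p) ξ⟩ := by
  have key : ∀ q, q = p → (⟨𝒢.unit q, (𝒢.dunit q (𝒢.dtgt (𝒢.unit p) ξ.1),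
      ContinuousLinearMap.comp (M₂ := E) ξ.2 (((𝒢.dmul (𝒢.unit q) (𝒢.unit p)).comp
        (ContinuousLinearMap.inl ℝ _ _)).comp
          (ContinuousLinearMap.id ℝ _ - 𝒢.dunitSrc q)))⟩ : Pontryagin E G) =
      ⟨𝒢.unit p,
        pontryaginFiberMap (𝒢.dunitTgt p) (ContinuousLinearMap.id ℝ _ - 𝒢.dunitSrc p) ξ⟩ := by
    rintro _ rfl
    congr 2
    exact congrArg (ContinuousLinearMap.comp ξ.2)
      (ContinuousLinearMap.ext (𝒢.dmul_unit_unit_zero_right _))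
  exact key _ (𝒢.tgt_unit p)

end LieGroupoid

/-! ### Smooth projections of vector subbundles -/

/-- Linear independence of finitely many continuous sections of a vector bundle, along a map into
its base, is an open condition. -/
theorem eventually_linearIndependent_section {B M V : Type*} {W : M → Type*} [TopologicalSpace B]
    [TopologicalSpace M] [NormedAddCommGroup V] [NormedSpace ℝ V]
    [∀ x, AddCommGroup (W x)] [∀ x, Module ℝ (W x)] [TopologicalSpace (Bundle.TotalSpace V W)]
    [∀ x, TopologicalSpace (W x)] [FiberBundle V W] [VectorBundle ℝ V W]
    {ι : Type*} [Finite ι] {f : B → M} {σ : ι → ∀ b, W (f b)} {b₀ : B} (hf : ContinuousAt f b₀)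
    (hσ : ∀ i, ContinuousAt (fun b => (⟨f b, σ i b⟩ : Bundle.TotalSpace V W)) b₀)
    (h : LinearIndependent ℝ fun i => σ i b₀) :
    ∀ᶠ b in nhds b₀, LinearIndependent ℝ fun i => σ i b := by
  set e := trivializationAt V W (f b₀)
  have he : ∀ b, f b ∈ e.baseSet → ((LinearIndependent ℝ fun i => σ i b) ↔
      LinearIndependent ℝ fun i => (e ⟨f b, σ i b⟩).2) := by
    intro b hb
    have h2 : (fun i => (e ⟨f b, σ i b⟩).2) =
        (e.continuousLinearEquivAt ℝ (f b) hb).toLinearEquiv.toLinearMap ∘ fun i => σ i b := by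
      funext i
      simp
    rw [h2]
    exact (LinearMap.linearIndependent_iff _ (LinearEquiv.ker _)).symm
  have hc : ContinuousAt (fun b i => (e ⟨f b, σ i b⟩).2) b₀ := continuousAt_pi.2 fun i =>
    ((FiberBundle.continuousAt_totalSpace V _).1 (hσ i)).2
  have hb₀ := FiberBundle.mem_baseSet_trivializationAt V W (f b₀)
  filter_upwards [hc.eventually ((he b₀ hb₀).1 h).eventually,
    hf (e.open_baseSet.mem_nhds hb₀)] with b hb hb'
  exact (he b hb').2 hb

section

variable {E : Type*} [NormedAddCommGroup E] [NormedSpace ℝ E]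
  {G : Type*} [TopologicalSpace G] [ChartedSpace E G] [IsManifold 𝓘(ℝ, E) ∞ G]
  {F : Type*} [NormedAddCommGroup F] [NormedSpace ℝ F]
  {B : Type*} [TopologicalSpace B] [ChartedSpace F B] {f : B → G}

/-- If `Q₁ + Q₂ = id` is a decomposition by smooth bundle maps which maps a smooth subbundle `W`
into two families `W₁`, `W₂` of independent subspaces of `W`, then `W₁ = Q₁ W` is a smooth
subbundle. Near a point, a frame of `W₁` is given by some of the images under `Q₁` of the sections
of a frame of `W`: the ranks of `W₁` and `W₂` can only grow near the point, while their sum is the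
rank of `W`. -/
theorem IsSmoothSubbundleAlong.of_add_eq_id (hf : Continuous f)
    {W W₁ W₂ : ∀ b, Submodule ℝ (PontryaginFiber E G (f b))}
    (hW : IsSmoothSubbundleAlong (F := F) f W) (h₁ : ∀ b, W₁ b ≤ W b)
    (hd : ∀ b, Disjoint (W₁ b) (W₂ b))
    {Q₁ Q₂ : ∀ b, PontryaginFiber E G (f b) →ₗ[ℝ] PontryaginFiber E G (f b)}
    (hQ : ∀ b ξ, Q₁ b ξ + Q₂ b ξ = ξ) (hQ₁ : ∀ b, ∀ ξ ∈ W b, Q₁ b ξ ∈ W₁ b)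
    (hQ₂ : ∀ b, ∀ ξ ∈ W b, Q₂ b ξ ∈ W₂ b)
    (hs₁ : ∀ (σ : ∀ b, PontryaginFiber E G (f b)) (U : Set B),
      ContMDiffOn 𝓘(ℝ, F) (𝓘(ℝ, E).prod 𝓘(ℝ, E × (E →L[ℝ] ℝ))) ∞
        (fun b => (⟨f b, σ b⟩ : Pontryagin E G)) U →
      ContMDiffOn 𝓘(ℝ, F) (𝓘(ℝ, E).prod 𝓘(ℝ, E × (E →L[ℝ] ℝ))) ∞
        (fun b => (⟨f b, Q₁ b (σ b)⟩ : Pontryagin E G)) U)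
    (hs₂ : ∀ (σ : ∀ b, PontryaginFiber E G (f b)) (U : Set B),
      ContMDiffOn 𝓘(ℝ, F) (𝓘(ℝ, E).prod 𝓘(ℝ, E × (E →L[ℝ] ℝ))) ∞
        (fun b => (⟨f b, σ b⟩ : Pontryagin E G)) U →
      ContMDiffOn 𝓘(ℝ, F) (𝓘(ℝ, E).prod 𝓘(ℝ, E × (E →L[ℝ] ℝ))) ∞
        (fun b => (⟨f b, Q₂ b (σ b)⟩ : Pontryagin E G)) U) :
    IsSmoothSubbundleAlong (F := F) f W₁ := by
  intro b₀
  obtain ⟨U, hU, hb₀, r, σ, hσ, hfr⟩ := hW b₀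
  have hσW : ∀ b ∈ U, ∀ i, σ i b ∈ W b := fun b hb i => by
    rw [← (hfr b hb).2]; exact Submodule.subset_span ⟨i, rfl⟩
  obtain ⟨κ₁, a₁, ha₁, hsp₁, hli₁⟩ := exists_linearIndependent' ℝ fun i => Q₁ b₀ (σ i b₀)
  obtain ⟨κ₂, a₂, ha₂, hsp₂, hli₂⟩ := exists_linearIndependent' ℝ fun i => Q₂ b₀ (σ i b₀)
  have : Finite κ₁ := Finite.of_injective a₁ ha₁
  have : Finite κ₂ := Finite.of_injective a₂ ha₂
  have := Fintype.ofFinite κ₁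
  have := Fintype.ofFinite κ₂
  let τ : κ₁ ⊕ κ₂ → ∀ b, PontryaginFiber E G (f b) :=
    Sum.elim (fun k b => Q₁ b (σ (a₁ k) b)) (fun k b => Q₂ b (σ (a₂ k) b))
  have hτW₁ : ∀ b ∈ U, ∀ k, τ (.inl k) b ∈ W₁ b := fun b hb k => hQ₁ b _ (hσW b hb _)
  have hτW₂ : ∀ b ∈ U, ∀ k, τ (.inr k) b ∈ W₂ b := fun b hb k => hQ₂ b _ (hσW b hb _)
  have hτW : ∀ b ∈ U, ∀ k, τ k b ∈ W b := by
    rintro b hb (k | k)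
    · exact h₁ b (hτW₁ b hb k)
    · have h := Submodule.sub_mem _ (hσW b hb (a₂ k)) (h₁ b (hQ₁ b _ (hσW b hb (a₂ k))))
      rwa [sub_eq_of_eq_add' (hQ b _).symm] at h
  have hτsum : ∀ b, (fun k => τ k b) =
      Sum.elim (fun k => τ (.inl k) b) (fun k => τ (.inr k) b) := fun b => by
    funext k; cases k <;> rfl
  have hspan : ∀ b, Submodule.span ℝ (Set.range fun k => τ k b) =
      Submodule.span ℝ (Set.range fun k => τ (.inl k) b) ⊔
        Submodule.span ℝ (Set.range fun k => τ (.inr k) b) := fun b => by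
    rw [hτsum, Set.Sum.elim_range, Submodule.span_union]
  have hle₁ : ∀ b ∈ U, Submodule.span ℝ (Set.range fun k => τ (.inl k) b) ≤ W₁ b := fun b hb => by
    rw [Submodule.span_le]; rintro _ ⟨k, rfl⟩; exact hτW₁ b hb k
  have hle₂ : ∀ b ∈ U, Submodule.span ℝ (Set.range fun k => τ (.inr k) b) ≤ W₂ b := fun b hb => by
    rw [Submodule.span_le]; rintro _ ⟨k, rfl⟩; exact hτW₂ b hb k
  have hle : ∀ b ∈ U, Submodule.span ℝ (Set.range fun k => τ k b) ≤ W b := fun b hb => by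
    rw [Submodule.span_le]; rintro _ ⟨k, rfl⟩; exact hτW b hb k
  have hli : LinearIndependent ℝ fun k => τ k b₀ := by
    rw [hτsum]
    exact LinearIndependent.sum_type hli₁ hli₂
      ((hd b₀).mono (hle₁ b₀ hb₀) (hle₂ b₀ hb₀))
  -- The sections chosen at `b₀` span `W b₀`, so that their number is the rank of `W`.
  have hcard : Fintype.card (κ₁ ⊕ κ₂) = r := by
    have hsp : Submodule.span ℝ (Set.range fun k => τ k b₀) = W b₀ := by
      refine le_antisymm (hle b₀ hb₀) ?_
      rw [← (hfr b₀ hb₀).2, Submodule.span_le]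
      rintro _ ⟨i, rfl⟩
      rw [hspan, SetLike.mem_coe]
      have e₁ : Q₁ b₀ (σ i b₀) ∈ Submodule.span ℝ (Set.range fun k => τ (.inl k) b₀) :=
        hsp₁.ge (Submodule.subset_span ⟨i, rfl⟩)
      have e₂ : Q₂ b₀ (σ i b₀) ∈ Submodule.span ℝ (Set.range fun k => τ (.inr k) b₀) :=
        hsp₂.ge (Submodule.subset_span ⟨i, rfl⟩)
      have e := Submodule.add_mem_sup e₁ e₂
      rwa [hQ] at e
    rw [← finrank_span_eq_card hli, hsp, ← (hfr b₀ hb₀).2, finrank_span_eq_card (hfr b₀ hb₀).1,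
      Fintype.card_fin]
  have hτs : ∀ k, ContMDiffOn 𝓘(ℝ, F) (𝓘(ℝ, E).prod 𝓘(ℝ, E × (E →L[ℝ] ℝ))) ∞
        (fun b => (⟨f b, τ k b⟩ : Pontryagin E G)) U := by
    rintro (k | k)
    · exact hs₁ _ U (hσ _)
    · exact hs₂ _ U (hσ _)
  have hev := eventually_linearIndependent_section (σ := τ) hf.continuousAt
    (fun k => (hτs k).continuousOn.continuousAt (hU.mem_nhds hb₀)) hli
  obtain ⟨O, hOsub, hO, hbO⟩ := eventually_nhds_iff.1 hev
  refine ⟨U ∩ O, hU.inter hO, ⟨hb₀, hbO⟩, Fintype.card κ₁,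
    fun i => τ (.inl ((Fintype.equivFin κ₁).symm i)), fun i => (hτs _).mono Set.inter_subset_left,
    fun b hb => ⟨?_, ?_⟩⟩
  · exact (hOsub b hb.2).comp _
      (Sum.inl_injective.comp (Fintype.equivFin κ₁).symm.injective)
  · have hfin : FiniteDimensional ℝ (W b) := by
      rw [← (hfr b hb.1).2]; exact FiniteDimensional.span_of_finite ℝ (Set.finite_range _)
    have hsp : Submodule.span ℝ (Set.range fun k => τ k b) = W b := by
      refine Submodule.eq_of_le_of_finrank_eq (hle b hb.1) ?_
      rw [finrank_span_eq_card (hOsub b hb.2), hcard, ← (hfr b hb.1).2,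
        finrank_span_eq_card (hfr b hb.1).1, Fintype.card_fin]
    have hrange : (Set.range fun i => τ (.inl ((Fintype.equivFin κ₁).symm i)) b) =
        Set.range fun k => τ (.inl k) b :=
      (Fintype.equivFin κ₁).symm.surjective.range_comp fun k => τ (.inl k) b
    rw [hrange]
    refine le_antisymm (hle₁ b hb.1) fun ξ hξ => ?_
    have hξ' := h₁ b hξ
    rw [← hsp, hspan] at hξ'
    obtain ⟨x, hx, y, hy, rfl⟩ := Submodule.mem_sup.1 hξ'
    -- The component in `W₂` of an element of `W₁` vanishes.
    have hy0 : y = 0 := Submodule.disjoint_def.1 (hd b) y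
      (by simpa using Submodule.sub_mem _ hξ (hle₁ b hb.1 hx)) (hle₂ b hb.1 hy)
    simpa [hy0] using hx

/-- The rank of a smooth subbundle is locally constant. -/
theorem IsSmoothSubbundleAlong.isLocallyConstant_finrank
    {W : ∀ b, Submodule ℝ (PontryaginFiber E G (f b))}
    (hW : IsSmoothSubbundleAlong (F := F) f W) :
    IsLocallyConstant fun b => Module.finrank ℝ (W b) := by
  refine (IsLocallyConstant.iff_exists_open _).2 fun b₀ => ?_
  obtain ⟨U, hU, hb₀, r, σ, -, hfr⟩ := hW b₀
  have h : ∀ b ∈ U, Module.finrank ℝ (W b) = r := fun b hb => by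
    rw [← (hfr b hb).2, finrank_span_eq_card (hfr b hb).1, Fintype.card_fin]
  exact ⟨U, hU, hb₀, fun b hb => (h b hb).trans (h b₀ hb₀).symm⟩

end

/-! ### Smoothness of the projections -/

section

variable {E : Type*} [NormedAddCommGroup E] [NormedSpace ℝ E]
  {G : Type*} [TopologicalSpace G] [ChartedSpace E G] [IsManifold 𝓘(ℝ, E) ∞ G]
  {F : Type*} [NormedAddCommGroup F] [NormedSpace ℝ F]
  {B : Type*} [TopologicalSpace B] [ChartedSpace F B] {f : B → G}

/-- `a` is a smooth family of endomorphisms of the tangent spaces of `G` along `f`: it is a smooth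
map into the bundle `Hom(TG, TG)`. -/
abbrev IsSmoothEndAlong (f : B → G)
    (a : ∀ b, TangentSpace 𝓘(ℝ, E) (f b) →L[ℝ] TangentSpace 𝓘(ℝ, E) (f b)) : Prop :=
  ContMDiff 𝓘(ℝ, F) (𝓘(ℝ, E).prod 𝓘(ℝ, E →L[ℝ] E)) ∞
    (fun b => (⟨f b, a b⟩ : Bundle.TotalSpace (E →L[ℝ] E)
      (fun g : G => TangentSpace 𝓘(ℝ, E) g →L[ℝ] TangentSpace 𝓘(ℝ, E) g)))

theorem IsSmoothEndAlong.id_sub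
    {a : ∀ b, TangentSpace 𝓘(ℝ, E) (f b) →L[ℝ] TangentSpace 𝓘(ℝ, E) (f b)}
    (ha : IsSmoothEndAlong (F := F) f a) :
    IsSmoothEndAlong (F := F) f fun b => ContinuousLinearMap.id ℝ _ - a b := by
  intro b₀
  have h := (contMDiffAt_hom_bundle _).1 (ha b₀)
  refine (contMDiffAt_hom_bundle _).2 ⟨h.1, ?_⟩
  refine ((contMDiffAt_const (c := ContinuousLinearMap.id ℝ E)).sub h.2).congr_of_eventuallyEq ?_
  filter_upwards [h.1.continuousAt
    ((trivializationAt E (TangentSpace 𝓘(ℝ, E)) (f b₀)).open_baseSet.mem_nhds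
      (FiberBundle.mem_baseSet_trivializationAt' (f b₀)))] with b hb
  have hb' : f b ∈ (trivializationAt E (TangentSpace 𝓘(ℝ, E)) (f b₀)).baseSet := hb
  ext v
  simp [ContinuousLinearMap.inCoordinates_eq hb' hb']

/-- Smooth families `a`, `c` of endomorphisms turn a smooth section `(v, α)` into the smooth section
`(a v, α ∘ c)`. -/
theorem contMDiffOn_pontryaginFiberMap
    {a c : ∀ b, TangentSpace 𝓘(ℝ, E) (f b) →L[ℝ] TangentSpace 𝓘(ℝ, E) (f b)}
    (ha : IsSmoothEndAlong (F := F) f a) (hc : IsSmoothEndAlong (F := F) f c)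
    (σ : ∀ b, PontryaginFiber E G (f b)) (U : Set B)
    (hσ : ContMDiffOn 𝓘(ℝ, F) (𝓘(ℝ, E).prod 𝓘(ℝ, E × (E →L[ℝ] ℝ))) ∞
      (fun b => (⟨f b, σ b⟩ : Pontryagin E G)) U) :
    ContMDiffOn 𝓘(ℝ, F) (𝓘(ℝ, E).prod 𝓘(ℝ, E × (E →L[ℝ] ℝ))) ∞
      (fun b => (⟨f b, pontryaginFiberMap (a b) (c b) (σ b)⟩ : Pontryagin E G)) U := by
  intro b₀ hb₀
  have h := Bundle.contMDiffWithinAt_totalSpace.1 (hσ b₀ hb₀)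
  have hv : ContMDiffWithinAt 𝓘(ℝ, F) (𝓘(ℝ, E).prod 𝓘(ℝ, E)) ∞
      (fun b => (⟨f b, (σ b).1⟩ : Bundle.TotalSpace E (TangentSpace 𝓘(ℝ, E) : G → Type _))) U b₀ :=
    Bundle.contMDiffWithinAt_totalSpace.2 ⟨h.1, ((contMDiffWithinAt_prod_module_iff _).1 h.2).1⟩
  have hα : ContMDiffWithinAt 𝓘(ℝ, F) (𝓘(ℝ, E).prod 𝓘(ℝ, E →L[ℝ] ℝ)) ∞
      (fun b => (⟨f b, (σ b).2⟩ : Bundle.TotalSpace (E →L[ℝ] ℝ)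
        (fun g : G => TangentSpace 𝓘(ℝ, E) g →L[ℝ] Bundle.Trivial G ℝ g))) U b₀ :=
    Bundle.contMDiffWithinAt_totalSpace.2 ⟨h.1, ((contMDiffWithinAt_prod_module_iff _).1 h.2).2⟩
  have hv' := ((ha b₀).contMDiffWithinAt (s := U)).clm_bundle_apply hv
  have hc' := ((contMDiffAt_hom_bundle _).1 (hc b₀)).2.contMDiffWithinAt (s := U)
  have hα' : ContMDiffWithinAt 𝓘(ℝ, F) (𝓘(ℝ, E).prod 𝓘(ℝ, E →L[ℝ] ℝ)) ∞
      (fun b => (⟨f b, ContinuousLinearMap.comp (σ b).2 (c b)⟩ : Bundle.TotalSpace (E →L[ℝ] ℝ)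
        (fun g : G => TangentSpace 𝓘(ℝ, E) g →L[ℝ] Bundle.Trivial G ℝ g))) U b₀ := by
    have hα2 := (contMDiffWithinAt_hom_bundle _).1 hα
    refine (contMDiffWithinAt_hom_bundle _).2 ⟨h.1, ?_⟩
    refine (hα2.2.clm_comp hc').congr_of_eventuallyEq_of_mem ?_ hb₀
    filter_upwards [h.1.continuousWithinAt
      ((trivializationAt E (TangentSpace 𝓘(ℝ, E)) (f b₀)).open_baseSet.mem_nhds
      (FiberBundle.mem_baseSet_trivializationAt' (f b₀)))] with b hb
    have hb' : f b ∈ (trivializationAt E (TangentSpace 𝓘(ℝ, E)) (f b₀)).baseSet := hb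
    ext v
    rw [ContinuousLinearMap.inCoordinates_eq hb' (by simp),
      ContinuousLinearMap.inCoordinates_eq hb' (by simp),
      ContinuousLinearMap.inCoordinates_eq hb' hb']
    simp [Bundle.Trivialization.symm_apply_apply_mk _ hb']
  exact Bundle.contMDiffWithinAt_totalSpace.2 ⟨h.1,
    (Bundle.contMDiffWithinAt_totalSpace.1 hv').2.prodMk_space
      (Bundle.contMDiffWithinAt_totalSpace.1 hα').2⟩

/-- The differential of `φ : G → G` is smooth along any smooth map into the fixed points of `φ`. -/
theorem isSmoothEndAlong_mfderiv {φ : G → G} (hφ : ContMDiff 𝓘(ℝ, E) 𝓘(ℝ, E) ∞ φ)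
    (hf : ContMDiff 𝓘(ℝ, F) 𝓘(ℝ, E) ∞ f) (hfix : ∀ b, φ (f b) = f b) :
    IsSmoothEndAlong (F := F) f fun b => (mfderiv 𝓘(ℝ, E) 𝓘(ℝ, E) φ (f b) : E →L[ℝ] E) := by
  intro b₀
  refine (contMDiffAt_hom_bundle _).2 ⟨hf b₀, ?_⟩
  have h := ((hφ (f b₀)).mfderiv_const (m := ∞) (by simp)).comp b₀ (hf b₀)
  refine h.congr_of_eventuallyEq (.of_forall fun b => ?_)
  -- Both sides differ in the base points of the target only, where `φ (f b) = f b`.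
  have key : ∀ g g₀, g = f b → g₀ = f b₀ → ContinuousLinearMap.inCoordinates E
      (TangentSpace 𝓘(ℝ, E)) E (TangentSpace 𝓘(ℝ, E)) (f b₀) (f b) g₀ g
      (mfderiv 𝓘(ℝ, E) 𝓘(ℝ, E) φ (f b) : E →L[ℝ] E) =
      ContinuousLinearMap.inCoordinates E
      (TangentSpace 𝓘(ℝ, E)) E (TangentSpace 𝓘(ℝ, E)) (f b₀) (f b) (f b₀) (f b)
      (mfderiv 𝓘(ℝ, E) 𝓘(ℝ, E) φ (f b) : E →L[ℝ] E) := by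
    rintro _ _ rfl rfl; rfl
  exact (key _ _ (hfix b) (hfix b₀)).symm

end

namespace LieGroupoid

variable {E F : Type*} [NormedAddCommGroup E] [NormedSpace ℝ E]
  [NormedAddCommGroup F] [NormedSpace ℝ F]
  {G P : Type*} [TopologicalSpace G] [ChartedSpace E G]
  [TopologicalSpace P] [ChartedSpace F P]
  (𝒢 : LieGroupoid E F G P)

/-! ### The splittings over the units -/

theorem pontryaginFiberMap_src_mem_unitBundle (p : P) (ξ : PontryaginFiber E G (𝒢.unit p)) :
    pontryaginFiberMap (𝒢.dunitSrc p) (ContinuousLinearMap.id ℝ _ - 𝒢.dunitTgt p) ξ ∈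
      𝒢.unitBundle p := by
  refine ⟨⟨_, rfl⟩, ?_⟩
  rintro _ ⟨x, rfl⟩
  change ξ.2 (𝒢.dunit p x - 𝒢.dunit p (𝒢.dtgt (𝒢.unit p) (𝒢.dunit p x))) = 0
  erw [𝒢.dtgt_dunit, sub_self, map_zero]

theorem pontryaginFiberMap_tgt_mem_unitBundle (p : P) (ξ : PontryaginFiber E G (𝒢.unit p)) :
    pontryaginFiberMap (𝒢.dunitTgt p) (ContinuousLinearMap.id ℝ _ - 𝒢.dunitSrc p) ξ ∈
      𝒢.unitBundle p := by
  refine ⟨⟨_, rfl⟩, ?_⟩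
  rintro _ ⟨x, rfl⟩
  change ξ.2 (𝒢.dunit p x - 𝒢.dunit p (𝒢.dsrc (𝒢.unit p) (𝒢.dunit p x))) = 0
  erw [𝒢.dsrc_dunit, sub_self, map_zero]

theorem pontryaginFiberMap_mem_kerSrc (p : P) (ξ : PontryaginFiber E G (𝒢.unit p)) :
    pontryaginFiberMap (ContinuousLinearMap.id ℝ _ - 𝒢.dunitSrc p) (𝒢.dunitTgt p) ξ ∈
      𝒢.kerSrc (𝒢.unit p) := by
  refine ⟨?_, fun v hv => ?_⟩
  · change 𝒢.dsrc (𝒢.unit p) (ξ.1 - 𝒢.dunit p (𝒢.dsrc (𝒢.unit p) ξ.1)) = 0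
    rw [map_sub]
    exact sub_eq_zero.2 (𝒢.dsrc_dunit p _).symm
  · change ξ.2 (𝒢.dunit p (𝒢.dtgt (𝒢.unit p) v)) = 0
    have hv' : 𝒢.dtgt (𝒢.unit p) v = 0 := hv
    rw [hv']
    exact (congrArg ξ.2 (map_zero _)).trans (map_zero _)

theorem pontryaginFiberMap_mem_kerTgt (p : P) (ξ : PontryaginFiber E G (𝒢.unit p)) :
    pontryaginFiberMap (ContinuousLinearMap.id ℝ _ - 𝒢.dunitTgt p) (𝒢.dunitSrc p) ξ ∈
      𝒢.kerTgt (𝒢.unit p) := by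
  refine ⟨?_, fun v hv => ?_⟩
  · change 𝒢.dtgt (𝒢.unit p) (ξ.1 - 𝒢.dunit p (𝒢.dtgt (𝒢.unit p) ξ.1)) = 0
    rw [map_sub]
    exact sub_eq_zero.2 (𝒢.dtgt_dunit p _).symm
  · change ξ.2 (𝒢.dunit p (𝒢.dsrc (𝒢.unit p) v)) = 0
    have hv' : 𝒢.dsrc (𝒢.unit p) v = 0 := hv
    rw [hv']
    exact (congrArg ξ.2 (map_zero _)).trans (map_zero _)

/-- `TP ⊕ (TP)°` meets `T^s G ⊕ (T^t G)°` trivially, because `T G = TP ⊕ T^s G = TP ⊕ T^t G`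
over `P`. -/
theorem disjoint_unitBundle_kerSrc (p : P) :
    Disjoint (𝒢.unitBundle p) (𝒢.kerSrc (𝒢.unit p)) := by
  rw [Submodule.disjoint_def]
  rintro ⟨v, α⟩ ⟨⟨x, rfl⟩, hα⟩ ⟨hv, hα'⟩
  have hx : x = 0 := (𝒢.dsrc_dunit p x).symm.trans hv
  have hα0 : α = 0 := by
    ext v
    have e : v = 𝒢.dunitTgt p v + (v - 𝒢.dunitTgt p v) := (add_sub_cancel _ _).symm
    have e₁ : α (𝒢.dunitTgt p v) = 0 := hα _ ⟨_, rfl⟩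
    have e₂ : α (v - 𝒢.dunitTgt p v) = 0 := hα' _ (𝒢.pontryaginFiberMap_mem_kerTgt p (v, 0)).1
    rw [e, map_add, e₁, e₂, add_zero]
    rfl
  subst hx hα0
  exact Prod.ext (map_zero _) rfl

/-- `TP ⊕ (TP)°` meets `T^t G ⊕ (T^s G)°` trivially, because `T G = TP ⊕ T^s G = TP ⊕ T^t G`
over `P`. -/
theorem disjoint_unitBundle_kerTgt (p : P) :
    Disjoint (𝒢.unitBundle p) (𝒢.kerTgt (𝒢.unit p)) := by
  rw [Submodule.disjoint_def]
  rintro ⟨v, α⟩ ⟨⟨x, rfl⟩, hα⟩ ⟨hv, hα'⟩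
  have hx : x = 0 := (𝒢.dtgt_dunit p x).symm.trans hv
  have hα0 : α = 0 := by
    ext v
    have e : v = 𝒢.dunitSrc p v + (v - 𝒢.dunitSrc p v) := (add_sub_cancel _ _).symm
    have e₁ : α (𝒢.dunitSrc p v) = 0 := hα _ ⟨_, rfl⟩
    have e₂ : α (v - 𝒢.dunitSrc p v) = 0 := hα' _ (𝒢.pontryaginFiberMap_mem_kerSrc p (v, 0)).1
    rw [e, map_add, e₁, e₂, add_zero]
    rfl
  subst hx hα0
  exact Prod.ext (map_zero _) rfl

theorem pontryaginFiberMap_src_mem_diracUnits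
    {D : ∀ g : G, Submodule ℝ (PontryaginFiber E G g)}
    (hD : 𝒢.IsPontryaginSubgroupoid {ξ | ξ.2 ∈ D ξ.1}) (p : P) (ξ : PontryaginFiber E G (𝒢.unit p))
    (hξ : ξ ∈ D (𝒢.unit p)) :
    pontryaginFiberMap (𝒢.dunitSrc p) (ContinuousLinearMap.id ℝ _ - 𝒢.dunitTgt p) ξ ∈
      𝒢.diracUnits D p := by
  have h := hD.src_mem ⟨𝒢.unit p, ξ⟩ hξ
  rw [𝒢.pontryaginSrc_unit] at h
  exact ⟨h, 𝒢.pontryaginFiberMap_src_mem_unitBundle p ξ⟩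

theorem pontryaginFiberMap_tgt_mem_diracUnits
    {D : ∀ g : G, Submodule ℝ (PontryaginFiber E G g)}
    (hD : 𝒢.IsPontryaginSubgroupoid {ξ | ξ.2 ∈ D ξ.1}) (p : P) (ξ : PontryaginFiber E G (𝒢.unit p))
    (hξ : ξ ∈ D (𝒢.unit p)) :
    pontryaginFiberMap (𝒢.dunitTgt p) (ContinuousLinearMap.id ℝ _ - 𝒢.dunitSrc p) ξ ∈
      𝒢.diracUnits D p := by
  have h := hD.tgt_mem ⟨𝒢.unit p, ξ⟩ hξ
  rw [𝒢.pontryaginTgt_unit] at h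
  exact ⟨h, 𝒢.pontryaginFiberMap_tgt_mem_unitBundle p ξ⟩

/-- The projection complementary to the source map preserves `D`, since the source map does. -/
theorem pontryaginFiberMap_mem_diracCoreSrc
    {D : ∀ g : G, Submodule ℝ (PontryaginFiber E G g)}
    (hD : 𝒢.IsPontryaginSubgroupoid {ξ | ξ.2 ∈ D ξ.1}) (p : P) (ξ : PontryaginFiber E G (𝒢.unit p))
    (hξ : ξ ∈ D (𝒢.unit p)) :
    pontryaginFiberMap (ContinuousLinearMap.id ℝ _ - 𝒢.dunitSrc p) (𝒢.dunitTgt p) ξ ∈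
      𝒢.diracCoreSrc D p := by
  refine ⟨?_, 𝒢.pontryaginFiberMap_mem_kerSrc p ξ⟩
  have h := Submodule.sub_mem _ hξ (𝒢.pontryaginFiberMap_src_mem_diracUnits hD p ξ hξ).1
  rwa [sub_eq_of_eq_add' (pontryaginFiberMap_add_id_sub _ _ ξ).symm] at h

/-- The projection complementary to the target map preserves `D`, since the target map does. -/
theorem pontryaginFiberMap_mem_diracCoreTgt
    {D : ∀ g : G, Submodule ℝ (PontryaginFiber E G g)}
    (hD : 𝒢.IsPontryaginSubgroupoid {ξ | ξ.2 ∈ D ξ.1}) (p : P) (ξ : PontryaginFiber E G (𝒢.unit p))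
    (hξ : ξ ∈ D (𝒢.unit p)) :
    pontryaginFiberMap (ContinuousLinearMap.id ℝ _ - 𝒢.dunitTgt p) (𝒢.dunitSrc p) ξ ∈
      𝒢.diracCoreTgt D p := by
  refine ⟨?_, 𝒢.pontryaginFiberMap_mem_kerTgt p ξ⟩
  have h := Submodule.sub_mem _ hξ (𝒢.pontryaginFiberMap_tgt_mem_diracUnits hD p ξ hξ).1
  rwa [sub_eq_of_eq_add' (pontryaginFiberMap_add_id_sub _ _ ξ).symm] at h

theorem diracUnits_sup_diracCoreSrc
    {D : ∀ g : G, Submodule ℝ (PontryaginFiber E G g)}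
    (hD : 𝒢.IsPontryaginSubgroupoid {ξ | ξ.2 ∈ D ξ.1}) (p : P) :
    𝒢.diracUnits D p ⊔ 𝒢.diracCoreSrc D p = D (𝒢.unit p) := by
  refine le_antisymm (sup_le inf_le_left inf_le_left) fun ξ hξ => ?_
  have h := Submodule.add_mem_sup (𝒢.pontryaginFiberMap_src_mem_diracUnits hD p ξ hξ)
    (𝒢.pontryaginFiberMap_mem_diracCoreSrc hD p ξ hξ)
  rwa [pontryaginFiberMap_add_id_sub] at h

theorem diracUnits_sup_diracCoreTgt
    {D : ∀ g : G, Submodule ℝ (PontryaginFiber E G g)}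
    (hD : 𝒢.IsPontryaginSubgroupoid {ξ | ξ.2 ∈ D ξ.1}) (p : P) :
    𝒢.diracUnits D p ⊔ 𝒢.diracCoreTgt D p = D (𝒢.unit p) := by
  refine le_antisymm (sup_le inf_le_left inf_le_left) fun ξ hξ => ?_
  have h := Submodule.add_mem_sup (𝒢.pontryaginFiberMap_tgt_mem_diracUnits hD p ξ hξ)
    (𝒢.pontryaginFiberMap_mem_diracCoreTgt hD p ξ hξ)
  rwa [pontryaginFiberMap_add_id_sub] at h

theorem disjoint_diracUnits_diracCoreSrc (D : ∀ g : G, Submodule ℝ (PontryaginFiber E G g))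
    (p : P) : Disjoint (𝒢.diracUnits D p) (𝒢.diracCoreSrc D p) :=
  (𝒢.disjoint_unitBundle_kerSrc p).mono inf_le_right inf_le_right

theorem disjoint_diracUnits_diracCoreTgt (D : ∀ g : G, Submodule ℝ (PontryaginFiber E G g))
    (p : P) : Disjoint (𝒢.diracUnits D p) (𝒢.diracCoreTgt D p) :=
  (𝒢.disjoint_unitBundle_kerTgt p).mono inf_le_right inf_le_right

section Smooth

variable [IsManifold 𝓘(ℝ, E) ∞ G]

/-- `T ε ∘ T s` is the differential of `ε ∘ s : G → G`, which fixes the units. -/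
theorem isSmoothEndAlong_dunitSrc : IsSmoothEndAlong (F := F) 𝒢.unit 𝒢.dunitSrc := by
  have h := isSmoothEndAlong_mfderiv (F := F) (𝒢.unit_smooth.comp 𝒢.src_contMDiff) 𝒢.unit_smooth
    (fun p => congrArg 𝒢.unit (𝒢.src_unit p))
  refine h.congr fun p => ?_
  have key : ∀ q, q = p → ((𝒢.dunit q).comp (𝒢.dsrc (𝒢.unit p)) : E →L[ℝ] E) = 𝒢.dunitSrc p := by
    rintro _ rfl; rfl
  exact congrArg (Bundle.TotalSpace.mk (𝒢.unit p)) ((key _ (𝒢.src_unit p)).symm.trans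
    ((𝒢.hasMFDerivAt_unit _).comp _ (𝒢.hasMFDerivAt_src _)).mfderiv.symm)

/-- `T ε ∘ T t` is the differential of `ε ∘ t : G → G`, which fixes the units. -/
theorem isSmoothEndAlong_dunitTgt : IsSmoothEndAlong (F := F) 𝒢.unit 𝒢.dunitTgt := by
  have h := isSmoothEndAlong_mfderiv (F := F) (𝒢.unit_smooth.comp 𝒢.tgt_contMDiff) 𝒢.unit_smooth
    (fun p => congrArg 𝒢.unit (𝒢.tgt_unit p))
  refine h.congr fun p => ?_
  have key : ∀ q, q = p → ((𝒢.dunit q).comp (𝒢.dtgt (𝒢.unit p)) : E →L[ℝ] E) = 𝒢.dunitTgt p := by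
    rintro _ rfl; rfl
  exact congrArg (Bundle.TotalSpace.mk (𝒢.unit p)) ((key _ (𝒢.tgt_unit p)).symm.trans
    ((𝒢.hasMFDerivAt_unit _).comp _ (𝒢.hasMFDerivAt_tgt _)).mfderiv.symm)

/-- The restriction to the units of a smooth subbundle is smooth. -/
theorem isSmoothSubbundleAlong_unit {D : ∀ g : G, Submodule ℝ (PontryaginFiber E G g)}
    (hD : IsSmoothSubbundleAlong (F := E) (fun g : G => g) D) :
    IsSmoothSubbundleAlong (F := F) 𝒢.unit fun p => D (𝒢.unit p) := by
  intro p
  obtain ⟨U, hU, hp, r, σ, hσ, hfr⟩ := hD (𝒢.unit p)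
  exact ⟨𝒢.unit ⁻¹' U, hU.preimage 𝒢.unit_smooth.continuous, hp, r, fun i q => σ i (𝒢.unit q),
    fun i => (hσ i).comp 𝒢.unit_smooth.contMDiffOn subset_rfl, fun q hq => hfr _ hq⟩

theorem isSmoothOfConstantRank_of_isSmoothSubbundleAlong
    {W : ∀ p : P, Submodule ℝ (PontryaginFiber E G (𝒢.unit p))}
    (hW : IsSmoothSubbundleAlong (F := F) 𝒢.unit W) : 𝒢.IsSmoothOfConstantRank W where
  smooth := hW
  rank_locally_constant := hW.isLocallyConstant_finrank
  rank_constant _ _ hq := hW.isLocallyConstant_finrank.apply_eq_of_isPreconnected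
    isPreconnected_connectedComponent hq mem_connectedComponent

end Smooth

end LieGroupoid

end

theorem mainTheorem10 {E F G P : Type*}
    [NormedAddCommGroup E] [NormedSpace ℝ E] [FiniteDimensional ℝ E]
    [NormedAddCommGroup F] [NormedSpace ℝ F] [FiniteDimensional ℝ F]
    [TopologicalSpace G] [T2Space G] [ChartedSpace E G] [IsManifold 𝓘(ℝ, E) ∞ G]
    [TopologicalSpace P] [T2Space P] [ChartedSpace F P] [IsManifold 𝓘(ℝ, F) ∞ P]
    (𝒢 : LieGroupoid E F G P)
    (D : ∀ g : G, Submodule ℝ (PontryaginFiber E G g))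
    (hD : 𝒢.IsDiracGroupoid D) :
    (∀ p : P, Disjoint (𝒢.diracUnits D p) (𝒢.diracCoreTgt D p) ∧
      𝒢.diracUnits D p ⊔ 𝒢.diracCoreTgt D p = D (𝒢.unit p)) ∧
    (∀ p : P, Disjoint (𝒢.diracUnits D p) (𝒢.diracCoreSrc D p) ∧
      𝒢.diracUnits D p ⊔ 𝒢.diracCoreSrc D p = D (𝒢.unit p)) ∧
    𝒢.IsSmoothOfConstantRank (𝒢.diracUnits D) ∧
    𝒢.IsSmoothOfConstantRank (𝒢.diracCoreTgt D) ∧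
    𝒢.IsSmoothOfConstantRank (𝒢.diracCoreSrc D) := by
  have hm := hD.multiplicative
  have hW := 𝒢.isSmoothSubbundleAlong_unit hD.almostDirac.smooth
  have hA := 𝒢.isSmoothEndAlong_dunitSrc
  have hB := 𝒢.isSmoothEndAlong_dunitTgt
  refine ⟨fun p => ⟨𝒢.disjoint_diracUnits_diracCoreTgt D p, 𝒢.diracUnits_sup_diracCoreTgt hm p⟩,
    fun p => ⟨𝒢.disjoint_diracUnits_diracCoreSrc D p, 𝒢.diracUnits_sup_diracCoreSrc hm p⟩,
    𝒢.isSmoothOfConstantRank_of_isSmoothSubbundleAlong ?_,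
    𝒢.isSmoothOfConstantRank_of_isSmoothSubbundleAlong ?_,
    𝒢.isSmoothOfConstantRank_of_isSmoothSubbundleAlong ?_⟩
  · exact hW.of_add_eq_id 𝒢.unit_smooth.continuous (fun p => inf_le_left)
      (𝒢.disjoint_diracUnits_diracCoreSrc D) (fun p => pontryaginFiberMap_add_id_sub _ _)
      (𝒢.pontryaginFiberMap_src_mem_diracUnits hm) (𝒢.pontryaginFiberMap_mem_diracCoreSrc hm)
      (contMDiffOn_pontryaginFiberMap hA hB.id_sub) (contMDiffOn_pontryaginFiberMap hA.id_sub hB)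
  · exact hW.of_add_eq_id 𝒢.unit_smooth.continuous (fun p => inf_le_left)
      (fun p => (𝒢.disjoint_diracUnits_diracCoreTgt D p).symm)
      (fun p ξ => (add_comm _ _).trans (pontryaginFiberMap_add_id_sub _ _ ξ))
      (𝒢.pontryaginFiberMap_mem_diracCoreTgt hm) (𝒢.pontryaginFiberMap_tgt_mem_diracUnits hm)
      (contMDiffOn_pontryaginFiberMap hB.id_sub hA) (contMDiffOn_pontryaginFiberMap hB hA.id_sub)
  · exact hW.of_add_eq_id 𝒢.unit_smooth.continuous (fun p => inf_le_left)
      (fun p => (𝒢.disjoint_diracUnits_diracCoreSrc D p).symm)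
      (fun p ξ => (add_comm _ _).trans (pontryaginFiberMap_add_id_sub _ _ ξ))
      (𝒢.pontryaginFiberMap_mem_diracCoreSrc hm) (𝒢.pontryaginFiberMap_src_mem_diracUnits hm)
      (contMDiffOn_pontryaginFiberMap hA.id_sub hB) (contMDiffOn_pontryaginFiberMap hA hB.id_sub)
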